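/- Let $(\mathcal X,\mathcal B)$ be a measurable space, $P$ a probability measure on it, and let $\varphi:\mathbb R\to[0,+\infty]$ be a closed convex function with $\varphi(1)=0$ whose domain $\{\varphi<\infty\}$ is an interval with endpoints $a_\varphi<1<b_\varphi$ (finite or infinite); closed means that $\varphi(x)\to\varphi(a_\varphi)$ as $x\downarrow a_\varphi$ if $a_\varphi$ is finite, and $\varphi(x)\to\varphi(b_\varphi)$ as $x\uparrow b_\varphi$ if $b_\varphi$ is finite. Let $\varphi^*(t)=\sup_{x\in\mathbb R}\{tx-\varphi(x)\}$. For a signed finite measure $Q$ on $(\mathcal X,\mathcal B)$ put $\phi(Q,P)=\int\varphi\left(\frac{dQ}{dP}\right)dP$ if $Q\ll P$, and $\phi(Q,P)=+\infty$ otherwise. Let $\mathcal F$ be an arbitrary class of measurable functions $f:\mathcal X\to\mathbb R$, let $\mathcal B_b$ be the set of all bounded measurable real functions on $\mathcal X$, and let $\langle\mathcal F\cup\mathcal B_b\rangle$ be the linear span of $\mathcal F\cup\mathcal B_b$. Let $\mathcal M_{\mathcal F}$ be the set of all signed finite measures $Q$ with $\int|f|\,d|Q|<\infty$ for all $f\in\mathcal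 F$, equipped with the weakest topology $\tau_{\mathcal F}$ for which all maps $Q\mapsto\int f\,dQ$, $f\in\mathcal F\cup\mathcal B_b$, are continuous, and let $\mathcal M_{\mathcal F}(P)$ be the subspace of those $Q\in\mathcal M_{\mathcal F}$ with $Q\ll P$. For $f\in\langle\mathcal F\cup\mathcal B_b\rangle$ let $$\phi^*(f)=\sup_{Q\in\mathcal M_{\mathcal F}(P)}\left\{\int f\,dQ-\phi(Q,P)\right\}.$$ Assume that $\int|f|\,dP<\infty$ for all $f\in\mathcal F$. Then: 1. $\phi^*$ is proper on $\langle\mathcal F\cup\mathcal B_b\rangle$: it never takes the value $-\infty$ and is not identically $+\infty$. 2. For every $f\in\langle\mathcal F\cup\mathcal B_b\rangle$, the function $x\mapsto\varphi^*(f(x))$ is measurable, its negative part has finite $P$-integral (so that $\int\varphi^*(f)\,dP\in(-\infty,+\infty]$ is well defined), and $$\phi^*(f)=\int\varphi^*(f)\,dP.$$ 3. For every $Q\in\mathcal M_{\mathcal F}(P)$, $$\phi(Q,P)=\sup_{f\in\langle\mathcal F\cup\mathcal B_b\rangle}\left\{\int f\,dQ-\int\varphi^*(f)\,dP\right\}.$$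 4. The function $Q\mapsto\phi(Q,P)\in[0,+\infty]$ is lower semicontinuous on $\mathcal M_{\mathcal F}(P)$ with the topology induced by $\tau_{\mathcal F}$. -/

import Mathlib

open MeasureTheory Filter Topology
open scoped ENNReal NNReal

noncomputable section

namespace PhiDiv

/-! ### The convex function generating the divergence -/

/-- The domain of a function `φ : ℝ → [0, +∞]`, i.e. the set where it is finite. -/
def dom (φ : ℝ → ℝ≥0∞) : Set ℝ := {x | φ x < ∞}

/-- The left endpoint `a_φ ∈ [-∞, +∞]` of the domain. -/
def leftEnd (φ : ℝ → ℝ≥0∞) : EReal := ⨅ x ∈ dom φ, (x : EReal)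

/-- The right endpoint `b_φ ∈ [-∞, +∞]` of the domain. -/
def rightEnd (φ : ℝ → ℝ≥0∞) : EReal := ⨆ x ∈ dom φ, (x : EReal)

/-- A closed convex function `φ : ℝ → [0, +∞]` with `φ 1 = 0` whose domain (an interval, by
convexity) has endpoints `a_φ < 1 < b_φ`.  Closedness means that at each finite endpoint of the
domain, `φ` tends to its value at that endpoint along the domain side.
Convexity is over the semiring `ℝ≥0` because the values lie in `[0, +∞]`; for nonnegative
weights adding up to one this is the usual convexity inequality. -/
structure IsDivergenceGenerator (φ : ℝ → ℝ≥0∞) : Prop where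
  convex : ConvexOn ℝ≥0 Set.univ φ
  map_one : φ 1 = 0
  leftEnd_lt : leftEnd φ < 1
  lt_rightEnd : 1 < rightEnd φ
  closed_left : ∀ a : ℝ, leftEnd φ = a → Tendsto φ (𝓝[>] a) (𝓝 (φ a))
  closed_right : ∀ b : ℝ, rightEnd φ = b → Tendsto φ (𝓝[<] b) (𝓝 (φ b))

/-- The Fenchel-Legendre conjugate `φ^*(t) = sup_x (t x - φ x)`. -/
def conj (φ : ℝ → ℝ≥0∞) (t : ℝ) : EReal :=
  ⨆ x : ℝ, ((t * x : ℝ) : EReal) - (φ x : EReal)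

/-! ### Integrals -/

variable {X : Type*} [MeasurableSpace X]

/-- The integral of a function with values in `[-∞, +∞]`: the integral of its positive part minus
the integral of its negative part (meaningful if one of them is finite). -/
def eintegral (P : Measure X) (g : X → EReal) : EReal :=
  ((∫⁻ x, (g x).toENNReal ∂P : ℝ≥0∞) : EReal) - ((∫⁻ x, (-g x).toENNReal ∂P : ℝ≥0∞) : EReal)

/-- The integral `∫ f dQ` of a real function against a signed finite measure. -/
def sintegral (Q : SignedMeasure X) (f : X → ℝ) : ℝ := ∫ᵛ x, f x ∂•Q

open scoped Classical in
/-- The divergence `ϕ(Q, P) = ∫ φ(dQ/dP) dP` if `Q ≪ P`, and `+∞` otherwise. -/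
def divergence (φ : ℝ → ℝ≥0∞) (Q : SignedMeasure X) (P : Measure X) : ℝ≥0∞ :=
  if Q ≪ᵥ P.toENNRealVectorMeasure then ∫⁻ x, φ (Q.rnDeriv P x) ∂P else ∞

/-! ### The spaces in duality -/

/-- `𝓑_b`: bounded measurable real functions. -/
def boundedMeasurable (X : Type*) [MeasurableSpace X] : Set (X → ℝ) :=
  {f | Measurable f ∧ ∃ C : ℝ, ∀ x, |f x| ≤ C}

/-- `⟨𝓕 ∪ 𝓑_b⟩`: the linear span. -/
def funSpan (F : Set (X → ℝ)) : Submodule ℝ (X → ℝ) :=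
  Submodule.span ℝ (F ∪ boundedMeasurable X)

/-- `𝓜_𝓕`: the signed finite measures `Q` with `∫ |f| d|Q| < ∞` for all `f ∈ 𝓕`. -/
def measuresInt (F : Set (X → ℝ)) : Set (SignedMeasure X) :=
  {Q | ∀ f ∈ F, ∫⁻ x, ‖f x‖ₑ ∂Q.variation < ∞}

/-- `𝓜_𝓕(P)`: the members of `𝓜_𝓕` which are absolutely continuous with respect to `P`. -/
def measuresIntAC (F : Set (X → ℝ)) (P : Measure X) : Set (SignedMeasure X) :=
  {Q | Q ∈ measuresInt F ∧ Q ≪ᵥ P.toENNRealVectorMeasure}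

/-- `τ_𝓕`: the weakest topology on `𝓜_𝓕` making `Q ↦ ∫ f dQ` continuous for all
`f ∈ 𝓕 ∪ 𝓑_b`. -/
@[reducible]
def tau (F : Set (X → ℝ)) : TopologicalSpace (measuresInt F) :=
  ⨅ f ∈ F ∪ boundedMeasurable X,
    TopologicalSpace.induced (fun Q : measuresInt F => sintegral (Q : SignedMeasure X) f)
      inferInstance

/-- The topology induced by `τ_𝓕` on the subspace `𝓜_𝓕(P)`. -/
@[reducible]
def tauAC (F : Set (X → ℝ)) (P : Measure X) : TopologicalSpace (measuresIntAC F P) :=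
  TopologicalSpace.induced
    (fun Q : measuresIntAC F P => (⟨Q.1, Q.2.1⟩ : measuresInt F)) (tau F)

/-- The conjugate `ϕ^*(f) = sup_{Q ∈ 𝓜_𝓕(P)} (∫ f dQ - ϕ(Q, P))` of the divergence. -/
def divConj (φ : ℝ → ℝ≥0∞) (F : Set (X → ℝ)) (P : Measure X) (f : X → ℝ) : EReal :=
  ⨆ Q ∈ measuresIntAC F P, (sintegral Q f : EReal) - (divergence φ Q P : EReal)

end PhiDiv

end

/-! The theorem is a pointwise convex duality on the line, followed by an interchange of supremum
and integral. Closedness at the endpoints makes `φ` lower semicontinuous, so separating points from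
its epigraph gives `φ = φ**`. The suprema defining `φ*` and `φ**` can moreover be taken over
countably many affine functions (`exists_seq_iSup_affine_eq`).

Integrating Young's inequality `f q ≤ φ*(f) + φ(q)`, with `q = dQ/dP`, gives one half of both
duality formulas. For the other half, the maximum of the first `k + 1` affine functions is attained
at a measurable index (`argmaxUpTo`), and the slope at that index is a bounded measurable function
of the point. For `ϕ*(f)` this slope is the density of a competitor `Q`, which lies in `𝓜_𝓕(P)`
because `𝓕` is `P`-integrable. For `ϕ(Q, P)` it is a test function in `𝓑_b`. Monotone convergence
(`eintegral_iSup_le`) then lets `k → ∞`.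

Bounded test functions therefore suffice to recover `ϕ(Q, P)`, which is thus a supremum of
`τ_𝓕`-continuous extended-real functions, hence lower semicontinuous. Properness comes from `φ 1 =
0`, which forces `φ*(t) ≥ t`, and from `φ ≥ 0`, which forces `ϕ*(0) ≤ 0`. -/

noncomputable section

namespace PhiDiv

section

/-! ### Closed convex functions on the line -/

namespace IsDivergenceGenerator

variable {φ : ℝ → ℝ≥0∞}

theorem map_combo_le (hφ : IsDivergenceGenerator φ) {a b : ℝ} (ha : 0 ≤ a) (hb : 0 ≤ b)
    (hab : a + b = 1) (x y : ℝ) :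
    φ (a * x + b * y) ≤ ENNReal.ofReal a * φ x + ENNReal.ofReal b * φ y := by
  lift a to ℝ≥0 using ha
  lift b to ℝ≥0 using hb
  have h := hφ.convex.2 (Set.mem_univ x) (Set.mem_univ y) zero_le zero_le
    (by exact_mod_cast hab)
  simpa [NNReal.smul_def, ENNReal.smul_def] using h

/-- Convexity and the minimum value `φ 1 = 0` make `φ` nondecreasing along each ray issuing from
`1`. -/
theorem map_toward_one_le (hφ : IsDivergenceGenerator φ) {θ : ℝ} (h0 : 0 ≤ θ) (h1 : θ ≤ 1)
    (y : ℝ) : φ (1 + θ * (y - 1)) ≤ φ y := by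
  have h := hφ.map_combo_le (sub_nonneg.2 h1) h0 (by ring) 1 y
  rw [hφ.map_one, mul_zero, zero_add] at h
  calc φ (1 + θ * (y - 1)) = φ ((1 - θ) * 1 + θ * y) := by congr 1; ring
    _ ≤ ENNReal.ofReal θ * φ y := h
    _ ≤ 1 * φ y := by gcongr; simpa using h1
    _ = φ y := one_mul _

/-- A bound on the open segment from `1` to `y` persists at `y` when some point beyond `y` lies in
the domain. -/
theorem map_le_of_forall_segment_of_lt_top (hφ : IsDivergenceGenerator φ) {y l : ℝ} {s : ℝ≥0∞}
    (hs : s ≠ ∞) (hl : 1 < l) (hM : φ (1 + l * (y - 1)) < ∞)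
    (h : ∀ θ : ℝ, 0 < θ → θ < 1 → φ (1 + θ * (y - 1)) ≤ s) : φ y ≤ s := by
  set M := φ (1 + l * (y - 1))
  have ht : Tendsto (fun w : ℝ => ENNReal.ofReal w * s + ENNReal.ofReal (1 - w) * M)
      (𝓝[<] 1) (𝓝 s) := by
    have h1 : Tendsto (fun w : ℝ => ENNReal.ofReal w * s + ENNReal.ofReal (1 - w) * M)
        (𝓝 1) (𝓝 (ENNReal.ofReal 1 * s + ENNReal.ofReal (1 - 1) * M)) := by
      refine Tendsto.add ?_ ?_
      · exact ENNReal.Tendsto.mul_const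
          ((ENNReal.continuous_ofReal.tendsto _).comp tendsto_id) (Or.inr hs)
      · exact ENNReal.Tendsto.mul_const
          ((ENNReal.continuous_ofReal.tendsto _).comp (tendsto_const_nhds.sub tendsto_id))
          (Or.inr hM.ne)
    simpa using h1.mono_left nhdsWithin_le_nhds
  refine ge_of_tendsto ht ?_
  -- `y` is written as a combination, with weights `w` and `1 - w`, of the points of the ray with
  -- parameters `θ` and `l`. Solving `w θ + (1 - w) l = 1` gives `θ = l - (l - 1) / w`, which is
  -- positive exactly when `w > (l - 1) / l`.
  have hlow : (l - 1) / l < 1 := by rw [div_lt_one (by linarith)]; linarith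
  filter_upwards [Ioo_mem_nhdsLT hlow] with w hw
  have hl0 : 0 < l := by linarith
  have hw0 : 0 < w := lt_trans (div_pos (by linarith) hl0) hw.1
  have hθ : 0 < l - (l - 1) / w := by
    have := hw.1
    rw [div_lt_iff₀ hl0] at this
    rw [sub_pos, div_lt_iff₀ hw0]; linarith
  have hθ1 : l - (l - 1) / w < 1 := by
    have : l - 1 < (l - 1) / w := by
      rw [lt_div_iff₀ hw0]; nlinarith [hw.2]
    linarith
  have hc := hφ.map_combo_le hw0.le (sub_nonneg.2 hw.2.le) (by ring)
    (1 + (l - (l - 1) / w) * (y - 1)) (1 + l * (y - 1))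
  have he : w * (1 + (l - (l - 1) / w) * (y - 1)) + (1 - w) * (1 + l * (y - 1)) = y := by
    field_simp; ring
  rw [he] at hc
  exact hc.trans (by gcongr; exact h _ hθ hθ1)

/-- If no point of the ray beyond `y ≠ 1` is in the domain, then `y` is itself a finite endpoint,
since the open segment from `1` to `y` lies in the domain. Closedness then applies. -/
theorem map_le_of_forall_segment (hφ : IsDivergenceGenerator φ) {y : ℝ} {s : ℝ≥0∞}
    (hs : s ≠ ∞) (h : ∀ θ : ℝ, 0 < θ → θ < 1 → φ (1 + θ * (y - 1)) ≤ s) : φ y ≤ s := by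
  by_cases hM : ∃ l : ℝ, 1 < l ∧ φ (1 + l * (y - 1)) < ∞
  · obtain ⟨l, hl, hM⟩ := hM
    exact hφ.map_le_of_forall_segment_of_lt_top hs hl hM h
  push Not at hM
  rcases lt_trichotomy y 1 with hy | rfl | hy
  · have hseg : ∀ z, y < z → z < 1 → φ z ≤ s := fun z h1 h2 => by
      have := h ((z - 1) / (y - 1)) (div_pos_of_neg_of_neg (by linarith) (by linarith))
        ((div_lt_one_of_neg (by linarith)).2 (by linarith))
      rwa [div_mul_cancel₀ _ (by linarith), add_sub_cancel] at this
    have hend : leftEnd φ = y := by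
      refine le_antisymm ?_ (le_iInf₂ fun d hd => ?_)
      · refine ge_of_tendsto ((continuous_coe_real_ereal.tendsto y).mono_left
          (nhdsWithin_le_nhds (s := Set.Ioi y))) ?_
        filter_upwards [Ioo_mem_nhdsGT hy] with z hz
        exact iInf₂_le z ((hseg z hz.1 hz.2).trans_lt hs.lt_top)
      · by_contra hlt
        rw [EReal.coe_le_coe_iff, not_le] at hlt
        have := hM ((d - 1) / (y - 1)) ((one_lt_div_of_neg (by linarith)).2 (by linarith))
        rw [div_mul_cancel₀ _ (by linarith), add_sub_cancel] at this
        exact absurd hd (not_lt.2 this)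
    refine le_of_tendsto (hφ.closed_left y hend) ?_
    filter_upwards [Ioo_mem_nhdsGT hy] with z hz using hseg z hz.1 hz.2
  · simp [hφ.map_one]
  · have hseg : ∀ z, 1 < z → z < y → φ z ≤ s := fun z h1 h2 => by
      have := h ((z - 1) / (y - 1)) (div_pos (by linarith) (by linarith))
        ((div_lt_one (by linarith)).2 (by linarith))
      rwa [div_mul_cancel₀ _ (by linarith), add_sub_cancel] at this
    have hend : rightEnd φ = y := by
      refine le_antisymm (iSup₂_le fun d hd => ?_) ?_
      · by_contra hlt
        rw [EReal.coe_le_coe_iff, not_le] at hlt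
        have := hM ((d - 1) / (y - 1)) ((one_lt_div (by linarith)).2 (by linarith))
        rw [div_mul_cancel₀ _ (by linarith), add_sub_cancel] at this
        exact absurd hd (not_lt.2 this)
      · refine le_of_tendsto ((continuous_coe_real_ereal.tendsto y).mono_left
          (nhdsWithin_le_nhds (s := Set.Iio y))) ?_
        filter_upwards [Ioo_mem_nhdsLT hy] with z hz
        exact le_iSup₂ (f := fun (x : ℝ) (_ : x ∈ dom φ) => (x : EReal)) z
          ((hseg z hz.1 hz.2).trans_lt hs.lt_top)
    refine le_of_tendsto (hφ.closed_right y hend) ?_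
    filter_upwards [Ioo_mem_nhdsLT hy] with z hz using hseg z hz.1 hz.2

theorem lowerSemicontinuous (hφ : IsDivergenceGenerator φ) : LowerSemicontinuous φ := by
  intro y s hs
  obtain ⟨θ, h0, h1, hθ⟩ : ∃ θ : ℝ, 0 < θ ∧ θ < 1 ∧ s < φ (1 + θ * (y - 1)) := by
    by_contra! hcon
    exact absurd hs (not_lt.2 (hφ.map_le_of_forall_segment (ne_top_of_lt hs) hcon))
  have hy : y - 1 ≠ 0 := fun h => by
    rw [sub_eq_zero.1 h, hφ.map_one] at hs
    exact absurd hs not_lt_zero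
  -- The fixed point `1 + θ * (y - 1)`, where `φ` exceeds `s`, also lies between `1` and every `z`
  -- near `y`. Monotonicity along the ray carries the bound to `z`.
  have ht : Tendsto (fun z : ℝ => θ * (y - 1) / (z - 1)) (𝓝 y) (𝓝 (θ * (y - 1) / (y - 1))) :=
    tendsto_const_nhds.div (tendsto_id.sub_const 1) hy
  rw [mul_div_cancel_right₀ _ hy] at ht
  filter_upwards [ht (Ioo_mem_nhds h0 h1), (continuous_sub_right (1 : ℝ)).continuousAt.eventually_ne
    hy] with z hz hz1
  have := hφ.map_toward_one_le hz.1.le hz.2.le z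
  rw [div_mul_cancel₀ _ hz1] at this
  exact hθ.trans_le this

/-- Affine minorants separate the points below the graph. -/
theorem exists_affine_le (hφ : IsDivergenceGenerator φ) {x s : ℝ} (hs : (s : EReal) < φ x) :
    ∃ t c : ℝ, (∀ y : ℝ, ((t * y - c : ℝ) : EReal) ≤ φ y) ∧ s < t * x - c := by
  let A : Set (ℝ × ℝ) := {p | (φ p.1 : EReal) ≤ (p.2 : EReal)}
  have hA : ∀ {y r : ℝ}, (y, r) ∈ A ↔ (φ y : EReal) ≤ (r : EReal) := Iff.rfl
  have hA' : ∀ {y r : ℝ}, (y, r) ∈ A ↔ 0 ≤ r ∧ φ y ≤ ENNReal.ofReal r := fun {y r} => by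
    rw [hA]
    constructor
    · intro h
      have h0 : (0 : ℝ) ≤ r := by exact_mod_cast (EReal.coe_ennreal_nonneg (φ y)).trans h
      refine ⟨h0, ?_⟩
      have := EReal.toENNReal_le_toENNReal h
      simpa using this
    · rintro ⟨h0, h⟩
      have := EReal.coe_ennreal_le_coe_ennreal_iff.2 h
      rwa [EReal.coe_ennreal_ofReal, max_eq_left h0] at this
  have hconv : Convex ℝ A := by
    rintro ⟨y, r⟩ hy ⟨z, q⟩ hz a b ha hb hab
    have hy' := hA'.1 hy
    have hz' := hA'.1 hz
    refine hA'.2 ⟨add_nonneg (mul_nonneg ha hy'.1) (mul_nonneg hb hz'.1), ?_⟩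
    refine (hφ.map_combo_le ha hb hab y z).trans ?_
    change _ ≤ ENNReal.ofReal (a * r + b * q)
    rw [ENNReal.ofReal_add (mul_nonneg ha hy'.1) (mul_nonneg hb hz'.1), ENNReal.ofReal_mul ha,
      ENNReal.ofReal_mul hb]
    gcongr
    exacts [hy'.2, hz'.2]
  have hlsc : LowerSemicontinuous fun y => (φ y : EReal) :=
    continuous_coe_ennreal_ereal.comp_lowerSemicontinuous hφ.lowerSemicontinuous
      EReal.coe_ennreal_strictMono.monotone
  have hclosed : IsClosed A :=
    hlsc.isClosed_epigraph.preimage (continuous_id.prodMap continuous_coe_real_ereal)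
  obtain ⟨L, u, hLx, hL⟩ := geometric_hahn_banach_point_closed hconv hclosed
    (show (x, s) ∉ A from fun h => absurd hs (not_lt.2 (hA.1 h)))
  obtain ⟨α, β, hαβ⟩ : ∃ α β : ℝ, ∀ y r, L (y, r) = α * y + β * r := by
    refine ⟨L (1, 0), L (0, 1), fun y r => ?_⟩
    have : ((y, r) : ℝ × ℝ) = y • (1, 0) + r • (0, 1) := by simp
    rw [this, map_add, map_smul, map_smul, smul_eq_mul, smul_eq_mul, mul_comm y, mul_comm r]
  rw [hαβ] at hLx
  have hepi : ∀ y r, (y, r) ∈ A → u < α * y + β * r := fun y r h => hαβ y r ▸ hL _ h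
  have htop : ∀ y, φ y = ∞ ∨ (y, (φ y).toReal) ∈ A := fun y => by
    rcases eq_or_ne (φ y) ∞ with h | h
    · exact Or.inl h
    · exact Or.inr (hA'.2 ⟨ENNReal.toReal_nonneg, by rw [ENNReal.ofReal_toReal h]⟩)
  -- The epigraph contains the upward vertical ray from `(1, 0)`, so `β < 0` would violate the lower
  -- bound `u`.
  have hβ : 0 ≤ β := by
    by_contra! hβ
    obtain ⟨n, hn⟩ := exists_nat_gt ((u - α) / β)
    have := hepi 1 n (hA'.2 ⟨n.cast_nonneg, by simp [hφ.map_one]⟩)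
    rw [div_lt_iff_of_neg hβ] at hn
    linarith
  rcases hβ.eq_or_lt with h0 | hpos
  · -- a vertical separating line
    subst h0
    simp only [zero_mul, add_zero] at hLx hepi
    -- Here `u - α * y` is negative on the domain and positive at `x`. A large multiple stays below
    -- `φ` and exceeds `s` at `x`.
    obtain ⟨n, hn⟩ := exists_nat_gt (s / (u - α * x))
    rw [div_lt_iff₀ (by linarith)] at hn
    refine ⟨-(n * α), -(n * u), fun y => ?_, by linarith⟩
    rcases htop y with h | h
    · simp [h]
    · refine le_trans ?_ (EReal.coe_ennreal_nonneg (φ y))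
      have := hepi y _ h
      have h2 : (n : ℝ) * u ≤ n * (α * y) := by gcongr
      exact_mod_cast (by linarith : -(n * α) * y - -(n * u) ≤ 0)
  · refine ⟨-(α / β), -(u / β), fun y => ?_, ?_⟩
    · rcases htop y with h | h
      · simp [h]
      · have h2 := hepi y _ h
        rw [← EReal.coe_ennreal_toReal (fun h' => by
          rw [hA, h'] at h; simp at h), EReal.coe_le_coe_iff]
        have : -(α / β) * y - -(u / β) = (u - α * y) / β := by field_simp; ring
        rw [this, div_le_iff₀ hpos]; linarith
    · have : -(α / β) * x - -(u / β) = (u - α * x) / β := by field_simp; ring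
      rw [this, lt_div_iff₀ hpos]; linarith

end IsDivergenceGenerator

/-! ### Countable families of affine functions -/

/-- A supremum of lower semicontinuous functions on the line is already the supremum of a countable
subfamily. -/
theorem exists_seq_iSup_affine_eq {S : Set (ℝ × ℝ)} (hS : S.Nonempty) :
    ∃ a c : ℕ → ℝ, (∀ k, (a k, c k) ∈ S) ∧
      ∀ t : ℝ, ⨆ p ∈ S, ((p.1 * t - p.2 : ℝ) : EReal) = ⨆ k, ((a k * t - c k : ℝ) : EReal) := by
  let A : ℝ × ℝ → ℝ → EReal := fun p t => ((p.1 * t - p.2 : ℝ) : EReal)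
  have hlub : IsLUB (A '' S) (fun t => ⨆ p ∈ S, A p t) := by
    have := isLUB_biSup (s := S) (f := A)
    rwa [show (fun t => ⨆ p ∈ S, A p t) = ⨆ p ∈ S, A p by ext t; simp only [iSup_apply]]
  obtain ⟨T, hTS, hTc, hT⟩ := exists_countable_lowerSemicontinuous_isLUB (by
    rintro _ ⟨p, -, rfl⟩
    exact Continuous.lowerSemicontinuous (continuous_coe_real_ereal.comp (by fun_prop))) hlub
  obtain ⟨p₀, hp₀⟩ := hS
  -- Adding one member makes the countable family nonempty, so that `ℕ` can enumerate it.
  have hT' : IsLUB (insert (A p₀) T) (fun t => ⨆ p ∈ S, A p t) := by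
    refine ⟨?_, fun b hb => hT.2 fun f hf => hb (Set.mem_insert_of_mem _ hf)⟩
    rintro f (rfl | hf)
    · exact hlub.1 ⟨p₀, hp₀, rfl⟩
    · exact hT.1 hf
  obtain ⟨f, hf⟩ := (hTc.insert (A p₀)).exists_eq_range ⟨_, Set.mem_insert _ _⟩
  have hfS : ∀ k, ∃ p ∈ S, A p = f k := fun k => by
    have : f k ∈ insert (A p₀) T := hf ▸ Set.mem_range_self k
    rcases this with h | h
    · exact ⟨p₀, hp₀, h.symm⟩
    · exact hTS h
  choose p hpS hp using hfS
  refine ⟨fun k => (p k).1, fun k => (p k).2, hpS, fun t => ?_⟩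
  rw [hf] at hT'
  have := congrFun (hT'.unique (isLUB_iSup (f := f))) t
  rw [iSup_apply] at this
  simpa only [← hp] using! this

/-! ### Conjugate and biconjugate of the generator. -/

variable {φ : ℝ → ℝ≥0∞}

/-- The Fenchel-Young inequality. -/
theorem coe_sub_le_conj (t x : ℝ) : ((t * x : ℝ) : EReal) - (φ x : EReal) ≤ conj φ t :=
  le_iSup (fun x : ℝ => ((t * x : ℝ) : EReal) - (φ x : EReal)) x

/-- The test point is `x = 1`. This bound supplies the integrable minorant `f` of `φ* ∘ f`. -/
theorem IsDivergenceGenerator.coe_le_conj (hφ : IsDivergenceGenerator φ) (t : ℝ) :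
    (t : EReal) ≤ conj φ t := by
  simpa [hφ.map_one] using coe_sub_le_conj (φ := φ) t 1

theorem IsDivergenceGenerator.exists_seq_conj_eq (hφ : IsDivergenceGenerator φ) :
    ∃ a : ℕ → ℝ, (∀ k, φ (a k) ≠ ∞) ∧
      ∀ t : ℝ, conj φ t = ⨆ k, ((a k * t - (φ (a k)).toReal : ℝ) : EReal) := by
  obtain ⟨a, c, hS, h⟩ := exists_seq_iSup_affine_eq
    (S := {p : ℝ × ℝ | φ p.1 ≠ ∞ ∧ p.2 = (φ p.1).toReal}) ⟨(1, 0), by simp [hφ.map_one]⟩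
  refine ⟨a, fun k => (hS k).1, fun t => ?_⟩
  have hc : ∀ k, c k = (φ (a k)).toReal := fun k => (hS k).2
  simp only [hc] at h
  rw [← h t]
  apply le_antisymm
  · refine iSup_le fun x => ?_
    rcases eq_or_ne (φ x) ∞ with hx | hx
    · simp [hx]
    · refine le_trans (le_of_eq ?_) (le_iSup₂ (f := fun (p : ℝ × ℝ) (_ : p ∈ {p : ℝ × ℝ |
        φ p.1 ≠ ∞ ∧ p.2 = (φ p.1).toReal}) => ((p.1 * t - p.2 : ℝ) : EReal))
        (x, (φ x).toReal) ⟨hx, rfl⟩)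
      rw [EReal.coe_sub, EReal.coe_ennreal_toReal hx, mul_comm]
  · refine iSup₂_le fun p hp => ?_
    rw [hp.2, EReal.coe_sub, EReal.coe_ennreal_toReal hp.1, mul_comm]
    exact coe_sub_le_conj t p.1

/-- The Fenchel-Moreau theorem for `φ`, with a countable family of affine minorants. -/
theorem IsDivergenceGenerator.exists_seq_biconj_eq (hφ : IsDivergenceGenerator φ) :
    ∃ t c : ℕ → ℝ, (∀ k, conj φ (t k) = c k) ∧
      ∀ x : ℝ, (φ x : EReal) = ⨆ k, ((t k * x - c k : ℝ) : EReal) := by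
  have key : ∀ {x s : ℝ}, (s : EReal) < φ x → ∃ t c : ℝ, conj φ t = c ∧ s < t * x - c := by
    intro x s hs
    obtain ⟨t, c, hle, hlt⟩ := hφ.exists_affine_le hs
    have h1 : conj φ t ≤ c := by
      refine iSup_le fun y => EReal.sub_le_of_le_add ?_
      have := add_le_add_right (hle y) (c : EReal)
      rwa [← EReal.coe_add, add_sub_cancel] at this
    have h2 := hφ.coe_le_conj t
    have h3 : ((conj φ t).toReal : EReal) = conj φ t :=
      EReal.coe_toReal (ne_top_of_le_ne_top (EReal.coe_ne_top c) h1)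
        (ne_bot_of_le_ne_bot (EReal.coe_ne_bot t) h2)
    -- The intercept is sharpened from `c` to the exact value `φ*(t)`, which only raises the affine
    -- function.
    refine ⟨t, (conj φ t).toReal, h3.symm, hlt.trans_le ?_⟩
    rw [← h3, EReal.coe_le_coe_iff] at h1
    linarith
  have hne : {p : ℝ × ℝ | conj φ p.1 = p.2}.Nonempty := by
    obtain ⟨t, c, h, -⟩ := key (x := 1) (s := -1) (by
      rw [hφ.map_one]; exact EReal.coe_lt_coe_iff.2 (by norm_num : (-1 : ℝ) < 0))
    exact ⟨(t, c), h⟩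
  obtain ⟨t, c, hS, h⟩ := exists_seq_iSup_affine_eq hne
  refine ⟨t, c, hS, fun x => ?_⟩
  rw [← h x]
  apply le_antisymm
  · refine EReal.le_of_forall_lt_iff_le.1 fun s hs => ?_
    by_contra hcon
    rw [not_le] at hcon
    obtain ⟨t, c, h1, h2⟩ := key hcon
    have := (le_iSup₂ (f := fun (p : ℝ × ℝ) (_ : p ∈ {p : ℝ × ℝ | conj φ p.1 = p.2}) =>
      ((p.1 * x - p.2 : ℝ) : EReal)) (t, c) h1).trans hs.le
    rw [EReal.coe_le_coe_iff] at this
    exact absurd h2 (not_lt.2 this)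
  · refine iSup₂_le fun p hp => ?_
    have h1 : ((p.1 * x : ℝ) : EReal) - φ x ≤ p.2 := (coe_sub_le_conj p.1 x).trans_eq hp
    rcases eq_or_ne (φ x) ∞ with hx | hx
    · simp [hx]
    · rw [← EReal.coe_ennreal_toReal hx, ← EReal.coe_sub, EReal.coe_le_coe_iff] at h1
      rw [← EReal.coe_ennreal_toReal hx, EReal.coe_le_coe_iff]
      linarith

theorem lowerSemicontinuous_conj : LowerSemicontinuous (conj φ) := by
  refine lowerSemicontinuous_iSup fun x => ?_
  rcases eq_or_ne (φ x) ∞ with hx | hx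
  · simp only [hx, EReal.coe_ennreal_top, EReal.sub_top]
    exact lowerSemicontinuous_const
  · simp only [← EReal.coe_ennreal_toReal hx, ← EReal.coe_sub]
    exact (continuous_coe_real_ereal.comp (by fun_prop)).lowerSemicontinuous

end

section

variable {X : Type*}

/-! ### The extended integral and monotone convergence -/

/-- An index at which the maximum of `g 0 x, …, g k x` is attained. -/
def argmaxUpTo (g : ℕ → X → ℝ) : ℕ → X → ℕ
  | 0, _ => 0
  | k + 1, x => if g (argmaxUpTo g k x) x < g (k + 1) x then k + 1 else argmaxUpTo g k x

theorem argmaxUpTo_le (g : ℕ → X → ℝ) (k : ℕ) (x : X) : argmaxUpTo g k x ≤ k := by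
  induction k with
  | zero => exact le_rfl
  | succ k ih => rw [argmaxUpTo]; split_ifs <;> omega

theorem le_argmaxUpTo (g : ℕ → X → ℝ) {j k : ℕ} (hjk : j ≤ k) (x : X) :
    g j x ≤ g (argmaxUpTo g k x) x := by
  induction k with
  | zero => rw [Nat.le_zero.1 hjk]; exact le_rfl
  | succ k ih =>
    rw [argmaxUpTo]
    rcases hjk.eq_or_lt with rfl | h
    · split_ifs with hlt
      exacts [le_rfl, not_lt.1 hlt]
    · split_ifs with hlt
      exacts [(ih (by omega)).trans hlt.le, ih (by omega)]

theorem monotone_argmaxUpTo (g : ℕ → X → ℝ) (x : X) :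
    Monotone fun k => g (argmaxUpTo g k x) x :=
  fun _ _ h => le_argmaxUpTo g ((argmaxUpTo_le g _ x).trans h) x

theorem iSup_argmaxUpTo (g : ℕ → X → ℝ) (x : X) :
    ⨆ k, (g (argmaxUpTo g k x) x : EReal) = ⨆ k, (g k x : EReal) :=
  le_antisymm (iSup_le fun _ => le_iSup (fun k => (g k x : EReal)) _)
    (iSup_mono fun _ => EReal.coe_le_coe_iff.2 (le_argmaxUpTo g le_rfl x))

variable [MeasurableSpace X]

theorem measurable_argmaxUpTo {g : ℕ → X → ℝ} (hg : ∀ k, Measurable (g k)) (k : ℕ) :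
    Measurable (argmaxUpTo g k) := by
  induction k with
  | zero => exact measurable_const
  | succ k ih =>
    have h : Measurable fun x => g (argmaxUpTo g k x) x :=
      (measurable_from_prod_countable_right (f := fun p : ℕ × X => g p.1 p.2) hg).comp
        (ih.prodMk measurable_id)
    exact Measurable.ite (measurableSet_lt h (hg _)) measurable_const ih

theorem measurable_comp_index {β : Type*} [MeasurableSpace β] {g : ℕ → X → β}
    (hg : ∀ k, Measurable (g k)) {N : X → ℕ} (hN : Measurable N) :
    Measurable fun x => g (N x) x :=
  (measurable_from_prod_countable_right (f := fun p : ℕ × X => g p.1 p.2) hg).comp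
    (hN.prodMk measurable_id)

theorem abs_comp_index_le {b : ℕ → ℝ} {n k : ℕ} (h : n ≤ k) :
    |b n| ≤ ∑ j ∈ Finset.range (k + 1), |b j| :=
  Finset.single_le_sum (f := fun j => |b j|) (fun _ _ => abs_nonneg _)
    (Finset.mem_range.2 (by omega))

theorem integrable_argmaxUpTo {P : Measure X} {g : ℕ → X → ℝ} (hg : ∀ k, Measurable (g k))
    (hi : ∀ k, Integrable (g k) P) (k : ℕ) :
    Integrable (fun x => g (argmaxUpTo g k x) x) P := by
  refine (integrable_finsetSum (Finset.range (k + 1)) fun j _ => (hi j).abs).mono'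
    (measurable_comp_index hg (measurable_argmaxUpTo hg k)).aestronglyMeasurable ?_
  exact .of_forall fun x => abs_comp_index_le (b := fun j => g j x) (argmaxUpTo_le g k x)

theorem eintegral_coe {P : Measure X} {u : X → ℝ} (hu : Integrable u P) :
    eintegral P (fun x => (u x : EReal)) = ((∫ x, u x ∂P : ℝ) : EReal) := by
  have h1 : ∫⁻ x, ENNReal.ofReal (u x) ∂P ≠ ∞ := by
    simpa using hu.lintegral_lt_top.ne
  have h2 : ∫⁻ x, ENNReal.ofReal (-u x) ∂P ≠ ∞ := by
    simpa using hu.neg.lintegral_lt_top.ne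
  rw [integral_eq_lintegral_pos_part_sub_lintegral_neg_part hu, EReal.coe_sub,
    EReal.coe_ennreal_toReal h1, EReal.coe_ennreal_toReal h2]
  simp only [eintegral, EReal.real_coe_toENNReal, ← EReal.coe_neg]

theorem eintegral_coe_ennreal {P : Measure X} (u : X → ℝ≥0∞) :
    eintegral P (fun x => (u x : EReal)) = ((∫⁻ x, u x ∂P : ℝ≥0∞) : EReal) := by
  have : ∀ x, (-(u x : EReal)).toENNReal = 0 := fun x =>
    EReal.toENNReal_of_nonpos (by
      simpa using EReal.neg_le_neg_iff.2 (EReal.coe_ennreal_nonneg (u x)))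
  simp only [eintegral, this, EReal.toENNReal_coe, lintegral_zero, EReal.coe_ennreal_zero, sub_zero]

theorem eintegral_mono {P : Measure X} {u v : X → EReal} (h : ∀ᵐ x ∂P, u x ≤ v x) :
    eintegral P u ≤ eintegral P v := by
  refine EReal.sub_le_sub (EReal.coe_ennreal_le_coe_ennreal_iff.2 (lintegral_mono_ae ?_))
    (EReal.coe_ennreal_le_coe_ennreal_iff.2 (lintegral_mono_ae ?_))
  · filter_upwards [h] with x hx using EReal.toENNReal_le_toENNReal hx
  · filter_upwards [h] with x hx using EReal.toENNReal_le_toENNReal (EReal.neg_le_neg_iff.2 hx)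

theorem lintegral_toENNReal_neg_lt_top {P : Measure X} {u : X → ℝ} (hu : Integrable u P)
    {v : X → EReal} (h : ∀ x, (u x : EReal) ≤ v x) :
    ∫⁻ x, (-v x).toENNReal ∂P < ∞ := by
  refine lt_of_le_of_lt (lintegral_mono fun x =>
    EReal.toENNReal_le_toENNReal (EReal.neg_le_neg_iff.2 (h x))) ?_
  simpa [← EReal.coe_neg] using hu.neg.lintegral_lt_top

theorem tendsto_eintegral_of_monotone {P : Measure X} {u : ℕ → X → ℝ}
    (hu : ∀ k, Integrable (u k) P) (hmono : ∀ x, Monotone fun k => u k x) :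
    Tendsto (fun k => ((∫ x, u k x ∂P : ℝ) : EReal)) atTop
      (𝓝 (eintegral P fun x => ⨆ k, (u k x : EReal))) := by
  have hlim : ∀ x, Tendsto (fun k => (u k x : EReal)) atTop (𝓝 (⨆ k, (u k x : EReal))) := fun x =>
    tendsto_atTop_iSup fun _ _ h => EReal.coe_le_coe_iff.2 (hmono x h)
  have hpos := lintegral_tendsto_of_tendsto_of_monotone (μ := P)
    (f := fun k x => (u k x : EReal).toENNReal)
    (F := fun x => (⨆ k, (u k x : EReal)).toENNReal)
    (fun k => (hu k).aemeasurable.coe_real_ereal.ereal_toENNReal)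
    (.of_forall fun x _ _ h => EReal.toENNReal_le_toENNReal (EReal.coe_le_coe_iff.2 (hmono x h)))
    (.of_forall fun x => (EReal.continuous_toENNReal.tendsto _).comp (hlim x))
  have hneg := lintegral_tendsto_of_tendsto_of_antitone (μ := P)
    (f := fun k x => (-(u k x : EReal)).toENNReal)
    (F := fun x => (-⨆ k, (u k x : EReal)).toENNReal)
    (fun k => by
      simpa only [← EReal.coe_neg, Pi.neg_apply] using (hu k).neg.aemeasurable.coe_real_ereal.ereal_toENNReal)
    (.of_forall fun x _ _ h => EReal.toENNReal_le_toENNReal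
      (EReal.neg_le_neg_iff.2 (EReal.coe_le_coe_iff.2 (hmono x h))))
    (lintegral_toENNReal_neg_lt_top (hu 0) fun _ => le_rfl).ne
    (.of_forall fun x => (EReal.continuous_toENNReal.tendsto _).comp
      ((continuous_neg.tendsto _).comp (hlim x)))
  have hfin : ∫⁻ x, (-⨆ k, (u k x : EReal)).toENNReal ∂P < ∞ :=
    lintegral_toENNReal_neg_lt_top (hu 0) fun x => le_iSup (fun k => (u k x : EReal)) 0
  simp only [← eintegral_coe (hu _)]
  simp only [eintegral, sub_eq_add_neg]
  -- The limiting negative part has finite integral, so the form `∞ - ∞` cannot occur.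
  refine (EReal.continuousAt_add (p := (_, _)) (Or.inr ?_) (Or.inl ?_)).tendsto.comp
    (((continuous_coe_ennreal_ereal.tendsto _).comp hpos).prodMk_nhds
      ((continuous_neg.tendsto _).comp
        ((continuous_coe_ennreal_ereal.tendsto _).comp hneg)))
  · simpa using hfin.ne
  · simp

/-- The integral of a countable supremum is approached along the finite maxima. -/
theorem eintegral_iSup_le {P : Measure X} {g : ℕ → X → ℝ} (hg : ∀ k, Measurable (g k))
    (hi : ∀ k, Integrable (g k) P) {b : EReal}
    (hb : ∀ k, ((∫ x, g (argmaxUpTo g k x) x ∂P : ℝ) : EReal) ≤ b) :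
    eintegral P (fun x => ⨆ k, (g k x : EReal)) ≤ b := by
  have := tendsto_eintegral_of_monotone (P := P) (integrable_argmaxUpTo hg hi)
    (monotone_argmaxUpTo g)
  simp only [iSup_argmaxUpTo] at this
  exact le_of_tendsto this (.of_forall hb)

end

section

variable {X : Type*} [MeasurableSpace X] {P : Measure X}

/-! ### Integration against signed measures with a density -/

theorem integrable_variation_withDensityᵥ_iff {q f : X → ℝ} (hq : Integrable q P)
    (hqm : Measurable q) (hf : Measurable f) :
    Integrable f (P.withDensityᵥ q).variation ↔ Integrable (fun x => f x * q x) P := by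
  rw [Measure.variation_withDensityᵥ hq,
    integrable_withDensity_iff_integrable_smul' hqm.enorm (.of_forall fun x => enorm_lt_top),
    ← integrable_norm_iff (f := fun x => f x * q x) (hf.mul hqm).aestronglyMeasurable,
    ← integrable_norm_iff]
  · simp [mul_comm]
  · exact (hqm.enorm.ennreal_toReal.smul hf).aestronglyMeasurable

theorem integral_smul_withDensityᵥ {q f : X → ℝ} (hq : Integrable q P) (hqm : Measurable q)
    (hf : Measurable f) (hfq : Integrable (fun x => f x * q x) P) :
    sintegral (P.withDensityᵥ q) f = ∫ x, f x * q x ∂P := by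
  have hfin := isFiniteMeasure_withDensity_ofReal hq.2
  have hfin' := isFiniteMeasure_withDensity_ofReal hq.neg.2
  have hposi : ∀ {p : X → ℝ}, Measurable p → (∀ x, |p x| = |q x|) →
      Integrable (fun x => (ENNReal.ofReal (p x)).toReal * f x) P := fun {p} hp habs => by
    refine hfq.norm.mono' (hp.ennreal_ofReal.ennreal_toReal.mul hf).aestronglyMeasurable
      (.of_forall fun x => ?_)
    rw [norm_mul, norm_mul, mul_comm]
    gcongr
    rw [Real.norm_eq_abs, Real.norm_eq_abs, ENNReal.toReal_ofReal', ← habs x,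
      abs_of_nonneg (le_max_right _ _)]
    exact max_le (le_abs_self _) (abs_nonneg _)
  have hpos := hposi hqm fun _ => rfl
  have hneg := hposi (p := fun x => -q x) hqm.neg fun x => abs_neg (q x)
  have hqm' : Measurable fun x => ENNReal.ofReal (-q x) := hqm.neg.ennreal_ofReal
  -- Multiplication of reals commutes, so the pairing may be flipped before
  -- `VectorMeasure.integral_toSignedMeasure` is applied.
  have hB : ContinuousLinearMap.lsmul ℝ ℝ = (ContinuousLinearMap.lsmul ℝ ℝ (E := ℝ)).flip := by
    ext; simp
  rw [sintegral, withDensityᵥ_eq_withDensity_pos_part_sub_withDensity_neg_part hq,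
    VectorMeasure.integral_sub_vectorMeasure, hB, VectorMeasure.integral_toSignedMeasure,
    VectorMeasure.integral_toSignedMeasure,
    integral_withDensity_eq_integral_toReal_smul hqm.ennreal_ofReal
      (.of_forall fun x => ENNReal.ofReal_lt_top),
    integral_withDensity_eq_integral_toReal_smul hqm'
      (.of_forall fun x => ENNReal.ofReal_lt_top)]
  · simp only [smul_eq_mul]
    rw [← integral_sub hpos hneg]
    refine integral_congr_ae (.of_forall fun x => ?_)
    simp only [ENNReal.toReal_ofReal']
    rw [← sub_mul, mul_comm (f x)]
    congr 1
    rcases le_total 0 (q x) with h | h <;> simp [h]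
  · rw [VectorMeasure.Integrable, Measure.variation_toSignedMeasure,
      integrable_withDensity_iff_integrable_smul' hqm.ennreal_ofReal
      (.of_forall fun x => ENNReal.ofReal_lt_top)]
    exact hpos
  · rw [VectorMeasure.Integrable, Measure.variation_toSignedMeasure,
      integrable_withDensity_iff_integrable_smul' hqm'
      (.of_forall fun x => ENNReal.ofReal_lt_top)]
    exact hneg

theorem divergence_withDensityᵥ [SigmaFinite P] (φ : ℝ → ℝ≥0∞) {q : X → ℝ}
    (hq : Integrable q P) :
    divergence φ (P.withDensityᵥ q) P = ∫⁻ x, φ (q x) ∂P := by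
  have hac := Measure.withDensityᵥ_absolutelyContinuous P q
  rw [divergence, if_pos hac]
  have h := SignedMeasure.withDensityᵥ_rnDeriv_eq _ P hac
  have := (SignedMeasure.integrable_rnDeriv _ P).ae_eq_of_withDensityᵥ_eq hq h
  exact lintegral_congr_ae (this.mono fun x hx => congrArg φ hx)

/-! ### The function spaces -/

variable {F : Set (X → ℝ)}

theorem measurable_of_mem_funSpan (hF : ∀ f ∈ F, Measurable f) {f : X → ℝ} (hf : f ∈ funSpan F) :
    Measurable f := by
  induction hf using Submodule.span_induction with
  | mem f h => exact h.elim (hF f) And.left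
  | zero => exact measurable_const
  | add f g _ _ hf hg => exact hf.add hg
  | smul a f _ hf => exact hf.const_smul a

theorem integrable_of_mem_funSpan {μ : Measure X} [IsFiniteMeasure μ]
    (hF : ∀ f ∈ F, Integrable f μ) {f : X → ℝ} (hf : f ∈ funSpan F) : Integrable f μ := by
  induction hf using Submodule.span_induction with
  | mem f h =>
    rcases h with h | ⟨hm, C, hC⟩
    · exact hF f h
    · exact Integrable.of_bound hm.aestronglyMeasurable C (.of_forall hC)
  | zero => exact integrable_zero _ _ _
  | add f g _ _ hf hg => exact hf.add hg
  | smul a f _ hf => exact hf.smul a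

theorem mem_funSpan_of_mem_boundedMeasurable {f : X → ℝ} (hf : f ∈ boundedMeasurable X) :
    f ∈ funSpan F :=
  Submodule.subset_span (Or.inr hf)

theorem withDensityᵥ_mem_measuresIntAC (hF : ∀ f ∈ F, Measurable f)
    (hFP : ∀ f ∈ F, ∫⁻ x, ‖f x‖ₑ ∂P < ∞) [IsFiniteMeasure P] {q : X → ℝ}
    (hq : q ∈ boundedMeasurable X) : P.withDensityᵥ q ∈ measuresIntAC F P := by
  obtain ⟨hqm, C, hC⟩ := hq
  refine ⟨fun f hf => ?_, Measure.withDensityᵥ_absolutelyContinuous P q⟩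
  have hfi : Integrable f P := ⟨(hF f hf).aestronglyMeasurable, hFP f hf⟩
  have hqi : Integrable q P := .of_bound hqm.aestronglyMeasurable C (.of_forall hC)
  exact ((integrable_variation_withDensityᵥ_iff hqi hqm (hF f hf)).2
    (hfi.mul_bdd hqm.aestronglyMeasurable (.of_forall hC))).2

/-- Every member of `𝓜_𝓕(P)` has a density, against which all of the span is integrable. -/
theorem exists_density [IsFiniteMeasure P] (hF : ∀ f ∈ F, Measurable f) {Q : SignedMeasure X}
    (hQ : Q ∈ measuresIntAC F P) :
    ∃ q : X → ℝ, Measurable q ∧ Integrable q P ∧ P.withDensityᵥ q = Q ∧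
      ∀ f ∈ funSpan F, Integrable (fun x => f x * q x) P := by
  have hq := SignedMeasure.integrable_rnDeriv Q P
  have hqm := SignedMeasure.measurable_rnDeriv Q P
  have hQq := SignedMeasure.withDensityᵥ_rnDeriv_eq Q P hQ.2
  refine ⟨Q.rnDeriv P, hqm, hq, hQq, fun f hf => ?_⟩
  rw [← integrable_variation_withDensityᵥ_iff hq hqm (measurable_of_mem_funSpan hF hf)]
  have : IsFiniteMeasure (P.withDensityᵥ (Q.rnDeriv P)).variation := by
    rw [Measure.variation_withDensityᵥ hq]
    exact isFiniteMeasure_withDensity hq.2.ne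
  refine integrable_of_mem_funSpan (fun g hg => ⟨(hF g hg).aestronglyMeasurable, ?_⟩) hf
  rw [hQq]
  exact hQ.1 g hg

/-! ### Duality -/

variable {φ : ℝ → ℝ≥0∞}

theorem measurable_conj_comp {f : X → ℝ} (hf : Measurable f) :
    Measurable fun x => conj φ (f x) :=
  lowerSemicontinuous_conj.measurable.comp hf

theorem IsDivergenceGenerator.measurable (hφ : IsDivergenceGenerator φ) : Measurable φ :=
  hφ.lowerSemicontinuous.measurable

/-- The Fenchel-Young inequality for the divergence. -/
theorem sintegral_sub_divergence_le [IsFiniteMeasure P] (hφ : IsDivergenceGenerator φ)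
    (hF : ∀ f ∈ F, Measurable f) {Q : SignedMeasure X} (hQ : Q ∈ measuresIntAC F P)
    {f : X → ℝ} (hf : f ∈ funSpan F) :
    (sintegral Q f : EReal) - (divergence φ Q P : EReal) ≤
      eintegral P fun x => conj φ (f x) := by
  obtain ⟨q, hqm, hq, rfl, hfq⟩ := exists_density hF hQ
  rw [divergence_withDensityᵥ φ hq,
    integral_smul_withDensityᵥ hq hqm (measurable_of_mem_funSpan hF hf) (hfq f hf)]
  have hm : Measurable fun x => φ (q x) := hφ.measurable.comp hqm
  rcases eq_or_ne (∫⁻ x, φ (q x) ∂P) ∞ with htop | hfin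
  · simp [htop]
  have hi : Integrable (fun x => (φ (q x)).toReal) P :=
    integrable_toReal_of_lintegral_ne_top hm.aemeasurable hfin
  have hlt : ∀ᵐ x ∂P, φ (q x) < ∞ := ae_lt_top hm hfin
  rw [← EReal.coe_ennreal_toReal hfin, ← EReal.coe_sub,
    ← integral_toReal hm.aemeasurable hlt, ← integral_sub (hfq f hf) hi,
    ← eintegral_coe (u := fun x => f x * q x - (φ (q x)).toReal) ((hfq f hf).sub hi)]
  refine eintegral_mono ?_
  filter_upwards [hlt] with x hx
  rw [EReal.coe_sub, EReal.coe_ennreal_toReal hx.ne]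
  exact coe_sub_le_conj (f x) (q x)

/-- The near-optimal measure has as density the slope of the largest of finitely many affine
functions at `f x`. With it, `f q - φ(q)` equals that maximum. -/
theorem eintegral_conj_le_divConj [IsFiniteMeasure P] (hφ : IsDivergenceGenerator φ)
    (hF : ∀ f ∈ F, Measurable f) (hFP : ∀ f ∈ F, ∫⁻ x, ‖f x‖ₑ ∂P < ∞) {f : X → ℝ}
    (hf : Measurable f) (hfi : Integrable f P) :
    (eintegral P fun x => conj φ (f x)) ≤ divConj φ F P f := by
  obtain ⟨a, ha, hconj⟩ := hφ.exists_seq_conj_eq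
  simp only [hconj]
  set g : ℕ → X → ℝ := fun k x => a k * f x - (φ (a k)).toReal with hg_def
  have hg : ∀ k, Measurable (g k) := fun k => (hf.const_mul _).sub_const _
  refine eintegral_iSup_le hg (fun k => (hfi.const_mul _).sub (integrable_const _)) fun k => ?_
  set N := argmaxUpTo g k
  have hN : Measurable N := measurable_argmaxUpTo hg k
  set q : X → ℝ := fun x => a (N x)
  have hqm : Measurable q := measurable_from_top.comp hN
  have hqb : ∀ x, |q x| ≤ ∑ j ∈ Finset.range (k + 1), |a j| := fun x =>
    abs_comp_index_le (argmaxUpTo_le g k x)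
  have hqi : Integrable q P := .of_bound hqm.aestronglyMeasurable _ (.of_forall hqb)
  have hfq : Integrable (fun x => f x * q x) P :=
    hfi.mul_bdd hqm.aestronglyMeasurable (.of_forall hqb)
  have hm : Measurable fun x => (φ (q x)).toReal :=
    (hφ.measurable.comp hqm).ennreal_toReal
  have hφi : Integrable (fun x => (φ (q x)).toReal) P :=
    .of_bound hm.aestronglyMeasurable _ (.of_forall fun x =>
      abs_comp_index_le (b := fun j => (φ (a j)).toReal) (argmaxUpTo_le g k x))
  refine le_trans (le_of_eq ?_) (le_iSup₂ (f := fun (Q : SignedMeasure X)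
    (_ : Q ∈ measuresIntAC F P) => (sintegral Q f : EReal) - (divergence φ Q P : EReal))
    (P.withDensityᵥ q) (withDensityᵥ_mem_measuresIntAC hF hFP ⟨hqm, _, hqb⟩))
  have hdiv : ((∫⁻ x, φ (q x) ∂P : ℝ≥0∞) : EReal) = ((∫ x, (φ (q x)).toReal ∂P : ℝ) : EReal) := by
    rw [← eintegral_coe hφi, ← eintegral_coe_ennreal]
    congr 1
    ext1 x
    rw [EReal.coe_ennreal_toReal (ha _)]
  rw [divergence_withDensityᵥ φ hqi, integral_smul_withDensityᵥ hqi hqm hf hfq, hdiv,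
    ← EReal.coe_sub, ← integral_sub hfq hφi]
  simp only [hg_def, mul_comm (f _), q, N]

theorem divConj_eq_eintegral [IsFiniteMeasure P] (hφ : IsDivergenceGenerator φ)
    (hF : ∀ f ∈ F, Measurable f) (hFP : ∀ f ∈ F, ∫⁻ x, ‖f x‖ₑ ∂P < ∞) {f : X → ℝ}
    (hf : f ∈ funSpan F) :
    divConj φ F P f = eintegral P fun x => conj φ (f x) :=
  le_antisymm (iSup₂_le fun _ hQ => sintegral_sub_divergence_le hφ hF hQ hf)
    (eintegral_conj_le_divConj hφ hF hFP (measurable_of_mem_funSpan hF hf)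
      (integrable_of_mem_funSpan (fun f hf => ⟨(hF f hf).aestronglyMeasurable, hFP f hf⟩) hf))

theorem IsDivergenceGenerator.eintegral_conj_ne_bot (hφ : IsDivergenceGenerator φ) {f : X → ℝ}
    (hfi : Integrable f P) : (eintegral P fun x => conj φ (f x)) ≠ ⊥ := by
  have h := eintegral_mono (P := P) (u := fun x => (f x : EReal)) (v := fun x => conj φ (f x))
    (.of_forall fun x => hφ.coe_le_conj (f x))
  rw [eintegral_coe hfi] at h
  exact ne_bot_of_le_ne_bot (EReal.coe_ne_bot _) h

/-- The divergence is recovered from bounded test functions alone. -/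
theorem divergence_le_iSup_boundedMeasurable [IsFiniteMeasure P] (hφ : IsDivergenceGenerator φ)
    (hF : ∀ f ∈ F, Measurable f) {Q : SignedMeasure X} (hQ : Q ∈ measuresIntAC F P) :
    (divergence φ Q P : EReal) ≤ ⨆ f ∈ boundedMeasurable X,
      (sintegral Q f : EReal) - eintegral P fun x => conj φ (f x) := by
  obtain ⟨q, hqm, hq, rfl, hfq⟩ := exists_density hF hQ
  obtain ⟨t, c, htc, hbi⟩ := hφ.exists_seq_biconj_eq
  rw [divergence_withDensityᵥ φ hq, ← eintegral_coe_ennreal]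
  simp only [hbi]
  set g : ℕ → X → ℝ := fun k x => t k * q x - c k with hg_def
  have hg : ∀ k, Measurable (g k) := fun k => (hqm.const_mul _).sub_const _
  refine eintegral_iSup_le hg (fun k => (hq.const_mul _).sub (integrable_const _)) fun k => ?_
  set N := argmaxUpTo g k
  have hN : Measurable N := measurable_argmaxUpTo hg k
  -- The slope of the largest minorant at `q x` is the test function. The intercepts being exact,
  -- `φ*(f x) = c (N x)`.
  set f : X → ℝ := fun x => t (N x)
  have hfb : f ∈ boundedMeasurable X := ⟨measurable_from_top.comp hN, _, fun x =>
    abs_comp_index_le (b := t) (argmaxUpTo_le g k x)⟩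
  have hfq' := hfq f (mem_funSpan_of_mem_boundedMeasurable hfb)
  have hm : Measurable fun x => c (N x) := measurable_from_top.comp hN
  have hci : Integrable (fun x => c (N x)) P :=
    .of_bound hm.aestronglyMeasurable _ (.of_forall fun x =>
      abs_comp_index_le (b := c) (argmaxUpTo_le g k x))
  refine le_trans (le_of_eq ?_) (le_iSup₂ (f := fun (f : X → ℝ)
    (_ : f ∈ boundedMeasurable X) => (sintegral (P.withDensityᵥ q) f : EReal) -
      eintegral P fun x => conj φ (f x)) f hfb)
  simp only [f, htc]
  rw [eintegral_coe hci, integral_smul_withDensityᵥ hq hqm hfb.1 hfq', ← EReal.coe_sub,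
    ← integral_sub hfq' hci]

theorem sintegral_sub_eintegral_conj_le [IsFiniteMeasure P] (hφ : IsDivergenceGenerator φ)
    (hF : ∀ f ∈ F, Measurable f) (hFP : ∀ f ∈ F, ∫⁻ x, ‖f x‖ₑ ∂P < ∞) {Q : SignedMeasure X}
    (hQ : Q ∈ measuresIntAC F P) {f : X → ℝ} (hf : f ∈ funSpan F) :
    ((sintegral Q f : EReal) - eintegral P fun x => conj φ (f x)) ≤ divergence φ Q P := by
  have hfi : Integrable f P :=
    integrable_of_mem_funSpan (fun f hf => ⟨(hF f hf).aestronglyMeasurable, hFP f hf⟩) hf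
  have h := sintegral_sub_divergence_le hφ hF hQ hf
  rw [EReal.sub_le_iff_le_add (Or.inl (EReal.coe_ennreal_ne_bot _))
    (Or.inr (hφ.eintegral_conj_ne_bot hfi))] at h
  exact EReal.sub_le_of_le_add' h

theorem continuous_sintegral_tauAC {f : X → ℝ} (hf : f ∈ boundedMeasurable X) :
    Continuous[tauAC F P, inferInstance] fun Q : measuresIntAC F P => sintegral Q.1 f := by
  rw [continuous_iff_le_induced]
  have h : tau F ≤ TopologicalSpace.induced
      (fun Q : measuresInt F => sintegral (Q : SignedMeasure X) f) inferInstance :=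
    biInf_le (fun f => TopologicalSpace.induced
      (fun Q : measuresInt F => sintegral (Q : SignedMeasure X) f) inferInstance) (Or.inr hf)
  refine (induced_mono h).trans_eq ?_
  rw [induced_compose]
  rfl

theorem lowerSemicontinuous_divergence [IsFiniteMeasure P] (hφ : IsDivergenceGenerator φ)
    (hF : ∀ f ∈ F, Measurable f) (hFP : ∀ f ∈ F, ∫⁻ x, ‖f x‖ₑ ∂P < ∞) :
    @LowerSemicontinuous (measuresIntAC F P) ℝ≥0∞ (tauAC F P) _
      (fun Q => divergence φ Q P) := by
  let _ := tauAC F P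
  intro Q y hy
  have h := (EReal.coe_ennreal_lt_coe_ennreal_iff.2 hy).trans_le
    (divergence_le_iSup_boundedMeasurable hφ hF Q.2)
  obtain ⟨f, h⟩ := lt_iSup_iff.1 h
  obtain ⟨hfb, hlt⟩ := lt_iSup_iff.1 h
  have hcont : Tendsto (fun R : measuresIntAC F P => (sintegral R.1 f : EReal)) (𝓝 Q)
      (𝓝 (sintegral Q.1 f : EReal)) :=
    (continuous_coe_real_ereal.tendsto _).comp ((continuous_sintegral_tauAC hfb).tendsto Q)
  have hsub : Tendsto (fun R : measuresIntAC F P => (sintegral R.1 f : EReal) -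
      eintegral P fun x => conj φ (f x)) (𝓝 Q)
      (𝓝 ((sintegral Q.1 f : EReal) - eintegral P fun x => conj φ (f x))) := by
    simp only [sub_eq_add_neg]
    -- The first summand is real, so addition is continuous here even if the integral of `φ* ∘ f` is
    -- `+∞`.
    exact (EReal.continuousAt_add (p := (_, _)) (Or.inl (EReal.coe_ne_top _))
      (Or.inl (EReal.coe_ne_bot _))).tendsto.comp (hcont.prodMk_nhds tendsto_const_nhds)
  filter_upwards [hsub (Ioi_mem_nhds hlt)] with R hR
  exact EReal.coe_ennreal_lt_coe_ennreal_iff.1 (hR.trans_le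
    (sintegral_sub_eintegral_conj_le hφ hF hFP R.2 (mem_funSpan_of_mem_boundedMeasurable hfb)))

theorem divConj_zero_le (F : Set (X → ℝ)) (P : Measure X) (φ : ℝ → ℝ≥0∞) :
    divConj φ F P 0 ≤ 0 := by
  refine iSup₂_le fun Q _ => ?_
  have : sintegral Q 0 = 0 := VectorMeasure.integral_zero
  rw [this, EReal.coe_zero, zero_sub]
  simpa using EReal.neg_le_neg_iff.2 (EReal.coe_ennreal_nonneg (divergence φ Q P))

end

end PhiDiv

end

theorem mainTheorem9 {X : Type*} [MeasurableSpace X] (P : Measure X) [IsProbabilityMeasure P]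
    (φ : ℝ → ℝ≥0∞) (hφ : PhiDiv.IsDivergenceGenerator φ)
    (F : Set (X → ℝ)) (hF : ∀ f ∈ F, Measurable f)
    (hFP : ∀ f ∈ F, ∫⁻ x, ‖f x‖ₑ ∂P < ∞) :
    -- the conjugate is proper: it never takes the value `-∞` and it is finite somewhere
    ((∀ f ∈ PhiDiv.funSpan F, PhiDiv.divConj φ F P f ≠ ⊥) ∧
      (∃ f ∈ PhiDiv.funSpan F, PhiDiv.divConj φ F P f ≠ ⊤)) ∧
    -- the integral of `φ^* ∘ f` is well defined and equals the conjugate at `f`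
    (∀ f ∈ PhiDiv.funSpan F,
      Measurable (fun x => PhiDiv.conj φ (f x)) ∧
      ∫⁻ x, (-PhiDiv.conj φ (f x)).toENNReal ∂P < ∞ ∧
      PhiDiv.divConj φ F P f = PhiDiv.eintegral P (fun x => PhiDiv.conj φ (f x))) ∧
    -- dual representation of the divergence
    (∀ Q ∈ PhiDiv.measuresIntAC F P,
      (PhiDiv.divergence φ Q P : EReal) =
        ⨆ f ∈ PhiDiv.funSpan F,
          (PhiDiv.sintegral Q f : EReal) -
            PhiDiv.eintegral P (fun x => PhiDiv.conj φ (f x))) ∧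
    -- lower semicontinuity of the divergence
    @LowerSemicontinuous (PhiDiv.measuresIntAC F P) ℝ≥0∞ (PhiDiv.tauAC F P) _
      (fun Q => PhiDiv.divergence φ Q P) := by
  have hint : ∀ f ∈ PhiDiv.funSpan F, Integrable f P := fun f hf =>
    PhiDiv.integrable_of_mem_funSpan
      (fun f hf => ⟨(hF f hf).aestronglyMeasurable, hFP f hf⟩) hf
  refine ⟨⟨fun f hf => ?_, 0, Submodule.zero_mem _, ?_⟩, fun f hf => ⟨?_, ?_, ?_⟩,
    fun Q hQ => le_antisymm ?_ ?_, PhiDiv.lowerSemicontinuous_divergence hφ hF hFP⟩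
  · rw [PhiDiv.divConj_eq_eintegral hφ hF hFP hf]
    exact hφ.eintegral_conj_ne_bot (hint f hf)
  · exact ne_top_of_le_ne_top EReal.zero_ne_top (PhiDiv.divConj_zero_le F P φ)
  · exact PhiDiv.measurable_conj_comp (PhiDiv.measurable_of_mem_funSpan hF hf)
  · exact PhiDiv.lintegral_toENNReal_neg_lt_top (hint f hf) fun x => hφ.coe_le_conj (f x)
  · exact PhiDiv.divConj_eq_eintegral hφ hF hFP hf
  · exact (PhiDiv.divergence_le_iSup_boundedMeasurable hφ hF hQ).trans
      (biSup_mono fun f hf => PhiDiv.mem_funSpan_of_mem_boundedMeasurable hf)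
  · exact iSup₂_le fun f hf => PhiDiv.sintegral_sub_eintegral_conj_le hφ hF hFP hQ hf
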